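/- Let $s,m\in\mathbb N$, $n_1,\dots,n_s\in\mathbb N$, $n=n_1+\dots+n_s$, and let $$E=\operatorname{diag}(E_1,\dots,E_s),\quad R=\operatorname{diag}(R_1,\dots,R_s),\quad Q=\operatorname{diag}(Q_1,\dots,Q_s)\in\mathbb R^{n\times n}$$ be block diagonal with $E_i,R_i,Q_i\in\mathbb R^{n_i\times n_i}$, let $B\in\mathbb R^{n\times m}$ be the block column with blocks $B_i\in\mathbb R^{n_i\times m}$, and let $J\in\mathbb R^{n\times n}$ be the block matrix with diagonal blocks $J_i\in\mathbb R^{n_i\times n_i}$, blocks $J_{ij}\in\mathbb R^{n_i\times n_j}$ in position $(i,j)$ and $-J_{ij}^\top$ in position $(j,i)$ for $i<j$. Assume that for all $i$: $R_i=R_i^\top\ge0$, $J_i^\top=-J_i$, $E_i^\top Q_i=Q_i^\top E_i\ge 0$, and $Q_i$ is invertible. Assume further that $\operatorname{rk}[E\ R\ J]=n$. Let $T>0$, $x_0\in\mathbb R^n$, $u\in L^2([0,T],\mathbb R^m)$, and let $Z\in\mathbb R^{n\times r}$, $Z_1\in\mathbb R^{r\times r_1}$ be matrices with full column rank such that $\operatorname{im}Z=\ker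 E$ and $\operatorname{im}Z_1=\ker RQZ\cap\ker Z^\top Q^\top JQZ$. Assume that $Z_1^\top Z^\top Q^\top Bu\in H^1([0,T],\mathbb R^{r_1})$ and $$Z_1^\top Z^\top Q^\top JQx_0+(Z_1^\top Z^\top Q^\top Bu)(0)=0,$$ where the value at $0$ is that of the continuous representative. Consider the initial value problem $$\tfrac{\mathrm d}{\mathrm dt}Ex(t)=(J-R)Qx(t)+Bu(t),\quad t\in[0,T],\qquad Ex(0)=Ex_0. \qquad (*)$$ A weak solution of $(*)$ is a function $x\in L^2([0,T],\mathbb R^n)$ such that $Ex\in H^1([0,T],\mathbb R^n)$, $(Ex)(0)=Ex_0$ (for the continuous representative of $Ex$), and the differential equation holds for almost every $t\in[0,T]$, with the weak derivative of $Ex$ on the left. Then: (a) The pencil $sE-(J-R)Q$ is regular, i.e. $\det(sE-(J-R)Q)$ is not the zero polynomial in $s$. (b) There is exactly one weak solution $x$ of $(*)$ in $L^2([0,T],\mathbb R^n)$ (that is, up to equality almost everywhere). (c) The index of $(*)$ is at most two, where, with $A=(J-R)Q$, the index is the smallest $\nu\in\mathbb N_0$ such that $\lambda\mapsto\lambda^{1-\nu}(\lambda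 E-A)^{-1}$ is defined and bounded outside some compact subset of $\mathbb C$. -/

import Mathlib

open MeasureTheory Set Matrix
open scoped ContDiff

noncomputable section

/-- Lebesgue measure on the time interval `[0, T]`. -/
def timeMeasure (T : ℝ) : Measure ℝ := volume.restrict (Icc 0 T)

/-- `f ∈ H¹([0, T], ℝ^κ)` with weak derivative `g`: both `f` and `g` are in `L²`, and
`∫ φ' f = - ∫ φ g` for all test functions `φ ∈ C_c^∞((0, T))`.
(On `κ → ℝ` with `κ` finite all norms are equivalent, so the choice of norm is immaterial.) -/
structure HasH1Deriv {κ : Type*} [Fintype κ] (T : ℝ) (f g : ℝ → κ → ℝ) : Prop where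
  memLp : MemLp f 2 (timeMeasure T)
  memLp_deriv : MemLp g 2 (timeMeasure T)
  integral_eq : ∀ φ : ℝ → ℝ, ContDiff ℝ ∞ φ → HasCompactSupport φ → tsupport φ ⊆ Ioo 0 T →
    ∫ t, deriv φ t • f t ∂(timeMeasure T) = - ∫ t, φ t • g t ∂(timeMeasure T)

/-- The Sobolev space `H¹([0, T], ℝ^κ)`. -/
def MemH1 {κ : Type*} [Fintype κ] (T : ℝ) (f : ℝ → κ → ℝ) : Prop :=
  ∃ g : ℝ → κ → ℝ, HasH1Deriv T f g

/-- `f(0) = v` for a function class `f` on `[0, T]` with a continuous representative: the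
continuous representative takes the value `v` at `0`. -/
def HasInitialValue {κ : Type*} [Fintype κ] (T : ℝ) (f : ℝ → κ → ℝ) (v : κ → ℝ) : Prop :=
  ∃ F : ℝ → κ → ℝ, ContinuousOn F (Icc 0 T) ∧ F =ᵐ[timeMeasure T] f ∧ F 0 = v

/-- Weak solutions `x ∈ L²([0, T], ℝ^ι)` of
`d/dt (E x) = (J - R) Q x + B u`, `E x(0) = E x₀`. -/
structure IsWeakSolution {ι κ : Type*} [Fintype ι] [Fintype κ] (E J R Q : Matrix ι ι ℝ)
    (B : Matrix ι κ ℝ) (T : ℝ) (x₀ : ι → ℝ) (u : ℝ → κ → ℝ) (x : ℝ → ι → ℝ) : Prop where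
  memLp : MemLp x 2 (timeMeasure T)
  memH1 : MemH1 T (fun t => E *ᵥ x t)
  initial : HasInitialValue T (fun t => E *ᵥ x t) (E *ᵥ x₀)
  equation : ∃ g : ℝ → ι → ℝ, HasH1Deriv T (fun t => E *ᵥ x t) g ∧
    ∀ᵐ t ∂(timeMeasure T), g t = ((J - R) * Q) *ᵥ x t + B *ᵥ u t

/-- The pencil `s E - A` is regular: `det (s E - A)` is not the zero polynomial. -/
def IsRegularPencil {ι : Type*} [Fintype ι] [DecidableEq ι] (E A : Matrix ι ι ℝ) : Prop :=
  ((Polynomial.X : Polynomial ℝ) • E.map Polynomial.C - A.map Polynomial.C).det ≠ 0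

/-- The complex matrix `z E - A`. -/
def complexPencil {ι : Type*} (E A : Matrix ι ι ℝ) (z : ℂ) : Matrix ι ι ℂ :=
  z • E.map Complex.ofReal - A.map Complex.ofReal

/-- `z ↦ z^(1-ν) (z E - A)⁻¹` is (defined and) bounded outside a compact subset of `ℂ`. -/
def ResolventGrowth {ι : Type*} [Fintype ι] [DecidableEq ι] (E A : Matrix ι ι ℝ) (ν : ℕ) : Prop :=
  ∃ K : Set ℂ, IsCompact K ∧ ∃ C : ℝ, ∀ z : ℂ, z ∉ K →
    IsUnit (complexPencil E A z) ∧
      ∀ i j, ‖z ^ (1 - (ν : ℤ)) * (complexPencil E A z)⁻¹ i j‖ ≤ C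

/-- The DAE `d/dt (E x) = A x + f` with regular pencil `s E - A` has index `ν`. -/
def HasIndex {ι : Type*} [Fintype ι] [DecidableEq ι] (E A : Matrix ι ι ℝ) (ν : ℕ) : Prop :=
  IsRegularPencil E A ∧ IsLeast {k : ℕ | ResolventGrowth E A k} ν

/-- The block matrix with diagonal blocks `Jd i`, blocks `Jo i j` above the diagonal (`i < j`)
and blocks `- (Jo i j)ᵀ` at the mirrored positions below the diagonal. Only the values
`Jo i j` with `i < j` matter. -/
def skewCoupling {s : ℕ} {n : Fin s → ℕ} (Jd : ∀ i, Matrix (Fin (n i)) (Fin (n i)) ℝ)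
    (Jo : ∀ i j, Matrix (Fin (n i)) (Fin (n j)) ℝ) :
    Matrix (Σ i, Fin (n i)) (Σ i, Fin (n i)) ℝ :=
  Matrix.of fun p q =>
    if p.1 < q.1 then Jo p.1 q.1 p.2 q.2
    else if q.1 < p.1 then - Jo q.1 p.1 q.2 p.2
    else Matrix.blockDiagonal' Jd p q

/-- The block column with blocks `B i`. -/
def blockColumn {s m : ℕ} {n : Fin s → ℕ} (B : ∀ i, Matrix (Fin (n i)) (Fin m) ℝ) :
    Matrix (Σ i, Fin (n i)) (Fin m) ℝ :=
  Matrix.of fun p k => B p.1 p.2 k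

end

/-! Multiplying the pencil `sE - (J - R)Q` from the left by the invertible `Qᵀ` gives `sM - (K - D)`
with `M = QᵀE` and `D = QᵀRQ` positive semidefinite and `K = QᵀJQ` skew. The rank condition says
that `M`, `D`, `K` have no common kernel vector. Pairing with `v` shows that `M - (K - D)` is
injective, so the pencil is invertible at `s = 1`, hence regular (`DissipativeTriple.isUnit`).

Let `S` be the inverse of `E - (J - R)Q` and `N = SE`. Then `sE - (J - R)Q = (E - (J - R)Q)(1 + (s -
1)N)`, so everything depends on `N`. The energy structure forces `ker N³ = ker N²`
(`DissipativeTriple.mulVec_pow_three`), so the space splits into a part where `N² = 0` and a part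
where `N` is invertible (`Matrix.exists_indexTwoSplitting`). On the first part the inverse of `1 +
(s - 1)N` is affine in `s`, on the second it is bounded for large `s`; this gives index at most two.

In time, the equation becomes `(Nx)' = Nx - x + v` with `v = SBu`. The invertible part is a linear
ODE. The nilpotent part has an explicit solution that differentiates only `NPv`, where `P` projects
onto it. Finally `NPS`, expressed in the transformed system, factors through `Z₁ᵀZᵀ`
(`DissipativeTriple.exists_factor`), so the regularity and compatibility assumptions on `Z₁ᵀZᵀQᵀBu`
are enough to solve it. -/

/-! ### Splitting off the nilpotent part of a matrix -/

/-- A splitting of the identity by an idempotent `P` commuting with `N` such that `N` is nilpotent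
of order two on the range of `P` and invertible, with inverse induced by `G`, on the kernel. -/
structure IndexTwoSplitting {𝔸 : Type*} [Ring 𝔸] (N P G : 𝔸) : Prop where
  comm : N * P = P * N
  idem : P * P = P
  nilp : N * (N * P) = 0
  left_inv : G * N = 1 - P
  right_inv : N * G = 1 - P
  comm_inv : P * G = G * P

/-- Transfers the splitting from real to complex matrices, where the resolvent is estimated. -/
theorem IndexTwoSplitting.map {𝔸 𝔹 : Type*} [Ring 𝔸] [Ring 𝔹] {N P G : 𝔸}
    (h : IndexTwoSplitting N P G) (f : 𝔸 →+* 𝔹) : IndexTwoSplitting (f N) (f P) (f G) where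
  comm := by rw [← map_mul, h.comm, map_mul]
  idem := by rw [← map_mul, h.idem]
  nilp := by rw [← map_mul, ← map_mul, h.nilp, map_zero]
  left_inv := by rw [← map_mul, h.left_inv, map_sub, map_one]
  right_inv := by rw [← map_mul, h.right_inv, map_sub, map_one]
  comm_inv := by rw [← map_mul, h.comm_inv, map_mul]

/-- Fitting decomposition by polynomials in `N`: Bézout for the factors of the characteristic
polynomial at and away from zero yields `P` and `G`, which therefore commute with `N` and each
other. The hypothesis lowers the nilpotency order to two. -/
theorem Matrix.exists_indexTwoSplitting {ι : Type*} [Fintype ι] [DecidableEq ι]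
    (N : Matrix ι ι ℝ) (hN : ∀ x, N *ᵥ (N *ᵥ (N *ᵥ x)) = 0 → N *ᵥ (N *ᵥ x) = 0) :
    ∃ P G : Matrix ι ι ℝ, IndexTwoSplitting N P G := by
  obtain ⟨q, hq, hXq⟩ := Polynomial.exists_eq_pow_rootMultiplicity_mul_and_not_dvd
    N.charpoly N.charpoly_monic.ne_zero 0
  set k := N.charpoly.rootMultiplicity 0
  rw [Polynomial.C_0, sub_zero] at hq hXq
  -- The exponent `k + 2` instead of `k` makes `hstab` applicable even when `k = 0` and leaves a
  -- factor `X` to split off in the definition of `G`.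
  have hcop : IsCoprime ((Polynomial.X : Polynomial ℝ) ^ (k + 2)) q :=
    ((Polynomial.irreducible_X.coprime_iff_not_dvd).2 hXq).pow_left
  obtain ⟨a, b, hab⟩ := hcop
  have hchar : Polynomial.aeval N (Polynomial.X ^ k * q) = 0 := by
    rw [← hq]; exact N.aeval_self_charpoly
  have hstab : ∀ j x, (N ^ (j + 2)) *ᵥ x = 0 → N *ᵥ (N *ᵥ x) = 0 := by
    intro j
    induction j with
    | zero => intro x hx; simpa [pow_two] using hx
    | succ j ih =>
      intro x hx
      refine hN x (ih (N *ᵥ x) ?_)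
      rw [mulVec_mulVec, ← pow_succ]
      exact hx
  have hN' : Polynomial.aeval N (Polynomial.X : Polynomial ℝ) = N := Polynomial.aeval_X N
  have hkP : N ^ (k + 2) * Polynomial.aeval N (b * q) = 0 := by
    have : (Polynomial.X : Polynomial ℝ) ^ (k + 2) * (b * q)
        = Polynomial.X ^ 2 * b * (Polynomial.X ^ k * q) := by ring
    rw [← hN', ← map_pow, hN', ← map_mul, this, map_mul, hchar, mul_zero]
  have hsum : Polynomial.aeval N (a * Polynomial.X ^ (k + 2)) = 1 - Polynomial.aeval N (b * q) := by
    rw [eq_sub_iff_add_eq, ← map_add, hab, map_one]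
  have hcomm : ∀ p r : Polynomial ℝ, Polynomial.aeval N p * Polynomial.aeval N r
      = Polynomial.aeval N r * Polynomial.aeval N p := fun p r => by
    rw [← map_mul, mul_comm, map_mul]
  refine ⟨Polynomial.aeval N (b * q), Polynomial.aeval N (a * Polynomial.X ^ (k + 1)),
    ?_, ?_, ?_, ?_, ?_, hcomm _ _⟩
  · have := hcomm Polynomial.X (b * q)
    rwa [hN'] at this
  · have h0 : Polynomial.aeval N (a * Polynomial.X ^ (k + 2)) * Polynomial.aeval N (b * q) = 0 := by
      rw [map_mul, map_pow, hN', mul_assoc, hkP, mul_zero]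
    rw [hsum, sub_mul, one_mul, sub_eq_zero] at h0
    exact h0.symm
  · refine Matrix.toLin'.injective (LinearMap.ext fun x => ?_)
    simp only [toLin'_apply, zero_mulVec, ← mulVec_mulVec]
    refine hstab k _ ?_
    rw [mulVec_mulVec, hkP, zero_mulVec]
  · rw [← hsum, pow_succ _ (k + 1), ← mul_assoc, map_mul _ (a * _), hN']
  · have := hcomm Polynomial.X (a * Polynomial.X ^ (k + 1))
    rw [hN'] at this
    rw [this, ← hsum, pow_succ _ (k + 1), ← mul_assoc, map_mul _ (a * _), hN']

/-! ### Dissipative Hamiltonian pencils `s M - (K - D)` -/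

/-- `M` and `D` are symmetric positive semidefinite, `K` is skew-symmetric and the three kernels
intersect trivially. -/
structure DissipativeTriple {ι : Type*} [Fintype ι] (M D K : Matrix ι ι ℝ) : Prop where
  symm_M : Mᵀ = M
  nonneg_M : ∀ v, 0 ≤ v ⬝ᵥ M *ᵥ v
  zero_M : ∀ v, v ⬝ᵥ M *ᵥ v = 0 → M *ᵥ v = 0
  symm_D : Dᵀ = D
  nonneg_D : ∀ v, 0 ≤ v ⬝ᵥ D *ᵥ v
  zero_D : ∀ v, v ⬝ᵥ D *ᵥ v = 0 → D *ᵥ v = 0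
  skew_K : Kᵀ = -K
  ker : ∀ v, M *ᵥ v = 0 → D *ᵥ v = 0 → K *ᵥ v = 0 → v = 0

namespace DissipativeTriple

variable {ι : Type*} [Fintype ι] {M D K S : Matrix ι ι ℝ}

theorem dotProduct_skew (h : DissipativeTriple M D K) (v w : ι → ℝ) :
    v ⬝ᵥ K *ᵥ w = - (w ⬝ᵥ K *ᵥ v) := by
  rw [dotProduct_mulVec, ← mulVec_transpose, h.skew_K, neg_mulVec, neg_dotProduct, dotProduct_comm]

theorem dotProduct_skew_self (h : DissipativeTriple M D K) (v : ι → ℝ) :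
    v ⬝ᵥ K *ᵥ v = 0 := by
  have := h.dotProduct_skew v v
  linarith

theorem dotProduct_M (h : DissipativeTriple M D K) (v w : ι → ℝ) :
    v ⬝ᵥ M *ᵥ w = w ⬝ᵥ M *ᵥ v := by
  rw [dotProduct_mulVec, ← mulVec_transpose, h.symm_M, dotProduct_comm]

theorem dotProduct_D (h : DissipativeTriple M D K) (v w : ι → ℝ) :
    v ⬝ᵥ D *ᵥ w = w ⬝ᵥ D *ᵥ v := by
  rw [dotProduct_mulVec, ← mulVec_transpose, h.symm_D, dotProduct_comm]

variable [DecidableEq ι]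

theorem isUnit (h : DissipativeTriple M D K) : IsUnit (M - (K - D)) := by
  rw [← mulVec_injective_iff_isUnit]
  refine (injective_iff_map_eq_zero (M - (K - D)).mulVecLin).2 fun v hv => ?_
  rw [mulVecLin_apply] at hv
  have h0 : v ⬝ᵥ (M - (K - D)) *ᵥ v = 0 := by rw [hv, dotProduct_zero]
  simp only [sub_mulVec, dotProduct_sub, h.dotProduct_skew_self] at h0
  have hM := h.nonneg_M v
  have hD := h.nonneg_D v
  have h1 := h.zero_M v (by linarith)
  have h2 := h.zero_D v (by linarith)
  refine h.ker v h1 h2 ?_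
  simpa [sub_mulVec, h1, h2] using hv

/-- With `b = SMx` and `a = SMb`, the identity `Mv = (M - K + D)SMv` gives `Ma = 0`. Pairing its
instances with `a` yields `Da = 0` and then `a ⬝ Kb = 0`, so `b ⬝ Mb = 0` and `Mb = 0`. This forces
`Ka = 0`, and the trivial common kernel gives `a = 0`. -/
theorem mulVec_pow_three (h : DissipativeTriple M D K) (hS : (M - (K - D)) * S = 1) (x : ι → ℝ)
    (hx : (S * M) *ᵥ ((S * M) *ᵥ ((S * M) *ᵥ x)) = 0) :
    (S * M) *ᵥ ((S * M) *ᵥ x) = 0 := by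
  have key : ∀ v, M *ᵥ v = M *ᵥ ((S * M) *ᵥ v) - K *ᵥ ((S * M) *ᵥ v) + D *ᵥ ((S * M) *ᵥ v) := by
    intro v
    have : M *ᵥ v = (M - (K - D)) *ᵥ ((S * M) *ᵥ v) := by
      rw [mulVec_mulVec, ← mul_assoc, hS, one_mul]
    rw [this, sub_mulVec, sub_mulVec]
    abel
  have h3 := key ((S * M) *ᵥ ((S * M) *ᵥ x))
  have h2 := key ((S * M) *ᵥ x)
  have h1 := key x
  rw [hx] at h3
  generalize (S * M) *ᵥ ((S * M) *ᵥ x) = a at *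
  generalize hb : (S * M) *ᵥ x = b at *
  simp only [mulVec_zero, sub_zero, add_zero] at h3
  rw [h3, zero_sub] at h2
  have hDa : D *ᵥ a = 0 := by
    apply h.zero_D
    have : a ⬝ᵥ M *ᵥ b = 0 := by rw [h.dotProduct_M, h3, dotProduct_zero]
    rw [h2, dotProduct_add, dotProduct_neg, h.dotProduct_skew_self] at this
    simpa using this
  rw [hDa, add_zero] at h2
  have hab : a ⬝ᵥ K *ᵥ b = 0 := by
    have : a ⬝ᵥ M *ᵥ x = 0 := by rw [h.dotProduct_M, h3, dotProduct_zero]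
    rw [h1, dotProduct_add, dotProduct_sub, h.dotProduct_M a b, h.dotProduct_D a b, h3, hDa] at this
    simpa using this
  have hMb : M *ᵥ b = 0 := by
    apply h.zero_M
    rw [h2, dotProduct_neg, h.dotProduct_skew, hab]
    simp
  rw [hMb] at h2
  exact h.ker a h3 hDa (neg_eq_zero.1 h2.symm)

/-- These are the conditions that describe `im (Z Z₁)`: in `ker M`, the requirement that `Kv` lie in
`im M` makes `Zᵀ K v` vanish. They come from `N²P = 0` for `N = SM`, read after transposition; `Dv =
0` follows by pairing `(-K - D)v ∈ im M` with `v ∈ ker M`. -/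
theorem transpose_mulVec_mem (h : DissipativeTriple M D K) (hS : (M - (K - D)) * S = 1)
    {P G : Matrix ι ι ℝ} (hP : IndexTwoSplitting (S * M) P G) (q : ι → ℝ) :
    M *ᵥ ((S * M * P * S)ᵀ *ᵥ q) = 0 ∧ D *ᵥ ((S * M * P * S)ᵀ *ᵥ q) = 0 ∧
      ∃ c, K *ᵥ ((S * M * P * S)ᵀ *ᵥ q) = M *ᵥ c := by
  have hS' : S * (M - (K - D)) = 1 := mul_eq_one_comm.1 hS
  have hM : M *ᵥ ((S * M * P * S)ᵀ *ᵥ q) = 0 := by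
    have : S * M * P * S * M = 0 := by
      rw [mul_assoc _ S M, mul_assoc, ← hP.comm, hP.nilp]
    nth_rewrite 1 [← h.symm_M]
    rw [mulVec_mulVec, ← transpose_mul, this, transpose_zero, zero_mulVec]
  have hA : (-K - D) *ᵥ ((S * M * P * S)ᵀ *ᵥ q) = - (M *ᵥ ((P * S)ᵀ *ᵥ q)) := by
    have h1 : S * M * P * S * (K - D) = - (P * S * M) := by
      have : S * (K - D) = S * M - 1 := by
        rw [← hS']; noncomm_ring
      rw [mul_assoc _ S, this, mul_sub, mul_assoc (S * M), ← hP.comm, hP.nilp, mul_one, zero_sub,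
        hP.comm, mul_assoc P]
    have h2 : (-K - D) = (K - D)ᵀ := by rw [transpose_sub, h.skew_K, h.symm_D]
    rw [h2, mulVec_mulVec, ← transpose_mul, h1, transpose_neg, transpose_mul, h.symm_M, neg_mulVec,
      mulVec_mulVec]
  set v := (S * M * P * S)ᵀ *ᵥ q
  have hD : D *ᵥ v = 0 := by
    apply h.zero_D
    have : v ⬝ᵥ (-K - D) *ᵥ v = 0 := by rw [hA, dotProduct_neg, h.dotProduct_M, hM]; simp
    rw [sub_mulVec, neg_mulVec, dotProduct_sub, dotProduct_neg, h.dotProduct_skew_self] at this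
    linarith
  refine ⟨hM, hD, (P * S)ᵀ *ᵥ q, ?_⟩
  rw [sub_mulVec, hD, sub_zero, neg_mulVec, neg_inj] at hA
  exact hA

end DissipativeTriple

/-! ### Growth of the resolvent -/

theorem IndexTwoSplitting.exists_inverse_bound {𝔸 : Type*} [NormedRing 𝔸] [NormedAlgebra ℂ 𝔸]
    [CompleteSpace 𝔸] {N P G : 𝔸} (h : IndexTwoSplitting N P G) :
    ∃ r C : ℝ, ∀ z : ℂ, r < ‖z‖ → ∃ W : 𝔸, (1 + (z - 1) • N) * W = 1 ∧ ‖z⁻¹ • W‖ ≤ C := by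
  have hO := (spectrum.resolvent_tendsto_cobounded (𝕜 := ℂ) (-G)).norm.eventually
    (Iio_mem_nhds (show ‖(0 : 𝔸)‖ < 1 by simp))
  have hU := (hO.and (spectrum.eventually_isUnit_resolvent (𝕜 := ℂ) (-G)))
  rw [(Filter.atTop_basis_Ioi (α := ℝ)).cobounded_of_norm.eventually_iff] at hU
  obtain ⟨r, -, hr⟩ := hU
  refine ⟨max (r + 1) 1, ‖P‖ + 2 * ‖P * N‖ + ‖(1 - P) * G‖, fun z hz => ?_⟩
  have hz1 : 1 < ‖z‖ := (le_max_right _ _).trans_lt hz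
  have hz0 : z ≠ 0 := norm_pos_iff.1 (by linarith)
  have hzr : r < ‖z - 1‖ := by
    have := norm_sub_norm_le z 1
    have := (le_max_left (r + 1) 1).trans_lt hz
    simp only [norm_one] at *
    linarith
  obtain ⟨hρ, hu⟩ := hr hzr
  replace hρ : ‖resolvent (-G) (z - 1)‖ < 1 := hρ
  have hu' : (algebraMap ℂ 𝔸 (z - 1) - -G) * resolvent (-G) (z - 1) = 1 :=
    Ring.mul_inverse_cancel _ (spectrum.isUnit_resolvent.2 hu)
  generalize resolvent (-G) (z - 1) = ρ at *
  generalize hζ : z - 1 = ζ at *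
  -- On `im P` the Neumann series of `1 + ζN` stops after the linear term; on `ker P` one has `1 +
  -- ζN = N(ζ + G)`, and `ρ` is the inverse of `ζ + G`.
  refine ⟨P * (1 - ζ • N) + (1 - P) * G * ρ, ?_, ?_⟩
  · have e1 : (1 + ζ • N) * (P * (1 - ζ • N)) = P := by
      have e : N * N * P = 0 := by rw [mul_assoc, h.nilp]
      simp only [add_mul, mul_sub, one_mul, mul_one, smul_mul_assoc, mul_smul_comm, ← mul_assoc, e,
        smul_zero, ← h.comm, add_zero, add_sub_cancel_right]
    have e2 : (1 + ζ • N) * ((1 - P) * G * ρ) = 1 - P := by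
      have e3 : (1 + ζ • N) * ((1 - P) * G) = (1 - P) * (algebraMap ℂ 𝔸 ζ - -G) := by
        have e4 : N * ((1 - P) * G) = 1 - P := by
          have : N * (1 - P) = (1 - P) * N := by rw [mul_sub, sub_mul, h.comm]; simp
          rw [← mul_assoc, this, mul_assoc, h.right_inv, sub_mul, mul_sub, mul_sub, h.idem]
          simp
        rw [add_mul, one_mul, smul_mul_assoc, e4, Algebra.algebraMap_eq_smul_one, sub_neg_eq_add,
          mul_add, mul_smul_comm, mul_one, add_comm]
      rw [← mul_assoc, e3, mul_assoc, hu', mul_one]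
    rw [mul_add, e1, e2, add_sub_cancel]
  · have e : z⁻¹ • (P * (1 - ζ • N) + (1 - P) * G * ρ)
        = z⁻¹ • P - (z⁻¹ * ζ) • (P * N) + z⁻¹ • ((1 - P) * G * ρ) := by
      rw [mul_sub, mul_one, mul_smul_comm, smul_add, smul_sub, smul_smul]
    have hzi : ‖z⁻¹‖ ≤ 1 := by rw [norm_inv]; exact inv_le_one_of_one_le₀ hz1.le
    have hzζ : ‖z⁻¹ * ζ‖ ≤ 2 := by
      rw [← hζ, mul_sub, inv_mul_cancel₀ hz0, mul_one]
      refine (norm_sub_le _ _).trans ?_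
      rw [norm_one]
      linarith
    rw [e]
    refine (norm_add_le _ _).trans (add_le_add ((norm_sub_le _ _).trans (add_le_add ?_ ?_)) ?_)
    · rw [norm_smul]
      exact mul_le_of_le_one_left (norm_nonneg _) hzi
    · rw [norm_smul]
      exact mul_le_mul_of_nonneg_right hzζ (norm_nonneg _)
    · rw [norm_smul]
      refine (mul_le_of_le_one_left (norm_nonneg _) hzi).trans ((norm_mul_le _ _).trans ?_)
      exact mul_le_of_le_one_right (norm_nonneg _) hρ.le

theorem resolventGrowth_two {ι : Type*} [Fintype ι] [DecidableEq ι] {E A S P G : Matrix ι ι ℝ}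
    (hS : (E - A) * S = 1) (h : IndexTwoSplitting (S * E) P G) : ResolventGrowth E A 2 := by
  let _ : NormedRing (Matrix ι ι ℂ) := Matrix.linftyOpNormedRing
  let _ : NormedAlgebra ℂ (Matrix ι ι ℂ) := Matrix.linftyOpNormedAlgebra
  have : CompleteSpace (Matrix ι ι ℂ) := FiniteDimensional.complete ℂ _
  let f : Matrix ι ι ℝ →+* Matrix ι ι ℂ := Complex.ofRealHom.mapMatrix
  obtain ⟨r, C, hC⟩ := (h.map f).exists_inverse_bound
  refine ⟨Metric.closedBall 0 r, isCompact_closedBall _ _, C * ‖f S‖, fun z hz => ?_⟩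
  rw [Metric.mem_closedBall, dist_zero_right, not_le] at hz
  obtain ⟨W, hW, hWC⟩ := hC z hz
  have hfac : complexPencil E A z = f (E - A) * (1 + (z - 1) • f (S * E)) := by
    have h1 : complexPencil E A z = z • f E - f A := rfl
    rw [h1, mul_add, mul_one, mul_smul_comm, ← map_mul, ← mul_assoc, hS, one_mul, map_sub, sub_smul,
      one_smul]
    abel
  have hinv : complexPencil E A z * (W * f S) = 1 := by
    rw [hfac, mul_assoc, ← mul_assoc _ W, hW, one_mul, ← map_mul, hS, map_one]
  refine ⟨IsUnit.of_mul_eq_one _ hinv, fun i j => ?_⟩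
  rw [Matrix.inv_eq_right_inv hinv]
  have e : z ^ (1 - ((2 : ℕ) : ℤ)) * (W * f S) i j = ((z⁻¹ • W) * f S) i j := by
    rw [smul_mul_assoc, Matrix.smul_apply, smul_eq_mul]
    norm_num
  rw [e]
  have hentry : ∀ X : Matrix ι ι ℂ, ‖X i j‖ ≤ ‖X‖ := by
    intro X
    rw [Matrix.linfty_opNorm_def]
    have h1 : ‖X i j‖₊ ≤ ∑ j, ‖X i j‖₊ :=
      Finset.single_le_sum (f := fun j => ‖X i j‖₊) (fun _ _ => zero_le) (Finset.mem_univ j)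
    have h2 : ∑ j, ‖X i j‖₊ ≤ Finset.univ.sup fun i => ∑ j, ‖X i j‖₊ :=
      Finset.le_sup (f := fun i => ∑ j, ‖X i j‖₊) (Finset.mem_univ i)
    exact_mod_cast h1.trans h2
  exact (hentry _).trans ((norm_mul_le _ _).trans
    (mul_le_mul_of_nonneg_right hWC (norm_nonneg _)))

theorem isRegularPencil_of_isUnit {ι : Type*} [Fintype ι] [DecidableEq ι] {E A : Matrix ι ι ℝ}
    (h : IsUnit (E - A)) : IsRegularPencil E A := by
  intro h0
  have h1 := congrArg (Polynomial.evalRingHom 1) h0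
  rw [RingHom.map_det, map_zero] at h1
  refine ((Matrix.isUnit_iff_isUnit_det _).1 h).ne_zero ?_
  rw [← h1]
  congr 1
  ext i j
  simp

/-! ### Weak derivatives and initial values on the time interval -/

theorem integral_timeMeasure {F : Type*} [NormedAddCommGroup F] [NormedSpace ℝ F] {T : ℝ}
    (hT : 0 ≤ T) (f : ℝ → F) : ∫ t, f t ∂(timeMeasure T) = ∫ t in (0 : ℝ)..T, f t := by
  rw [timeMeasure, integral_Icc_eq_integral_Ioc, intervalIntegral.integral_of_le hT]

theorem integral_timeMeasure_of_support {F : Type*} [NormedAddCommGroup F] [NormedSpace ℝ F]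
    {T : ℝ} {f : ℝ → F} (hf : Function.support f ⊆ Icc 0 T) :
    ∫ t, f t ∂(timeMeasure T) = ∫ t, f t :=
  setIntegral_eq_integral_of_forall_compl_eq_zero fun x hx => by
    by_contra h
    exact hx (hf h)

instance isFiniteMeasure_timeMeasure (T : ℝ) : IsFiniteMeasure (timeMeasure T) := by
  unfold timeMeasure
  infer_instance

theorem ae_timeMeasure_mem (T : ℝ) : ∀ᵐ t ∂(timeMeasure T), t ∈ Icc 0 T :=
  ae_restrict_mem measurableSet_Icc

theorem ae_timeMeasure_mem_Ioo (T : ℝ) : ∀ᵐ t ∂(timeMeasure T), t ∈ Ioo 0 T := by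
  rw [timeMeasure, Measure.restrict_congr_set Ioo_ae_eq_Icc.symm]
  exact ae_restrict_mem measurableSet_Ioo

theorem ContinuousOn.memLp_timeMeasure {F : Type*} [NormedAddCommGroup F] {T : ℝ} {f : ℝ → F}
    (hf : ContinuousOn f (Icc 0 T)) (p : ENNReal) : MemLp f p (timeMeasure T) := by
  obtain ⟨C, hC⟩ := isCompact_Icc.exists_bound_of_continuousOn hf
  refine MemLp.of_bound (hf.aestronglyMeasurable_of_isCompact isCompact_Icc measurableSet_Icc) C ?_
  filter_upwards [ae_timeMeasure_mem T] with t ht using hC t ht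

/-- Multiplication by a matrix as a continuous linear map. -/
noncomputable def Matrix.mulVecCLM {κ κ' : Type*} [Fintype κ] [Fintype κ'] (A : Matrix κ' κ ℝ) :
    (κ → ℝ) →L[ℝ] (κ' → ℝ) :=
  LinearMap.toContinuousLinearMap A.mulVecLin

@[simp]
theorem Matrix.mulVecCLM_apply {κ κ' : Type*} [Fintype κ] [Fintype κ'] (A : Matrix κ' κ ℝ)
    (v : κ → ℝ) : A.mulVecCLM v = A *ᵥ v := rfl

section H1

variable {κ κ' : Type*} [Fintype κ] [Fintype κ'] {T : ℝ} {f f' g g' : ℝ → κ → ℝ}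

theorem MeasureTheory.MemLp.matrix_mulVec {p : ENNReal} {μ : Measure ℝ} (hf : MemLp f p μ)
    (A : Matrix κ' κ ℝ) : MemLp (fun t => A *ᵥ f t) p μ :=
  A.mulVecCLM.comp_memLp' hf

theorem integrable_timeMeasure (hf : MemLp f 2 (timeMeasure T)) : Integrable f (timeMeasure T) :=
  hf.integrable one_le_two

theorem integrable_timeMeasure_smul {φ : ℝ → ℝ} (hφ : Continuous φ)
    (hf : Integrable f (timeMeasure T)) : Integrable (fun t => φ t • f t) (timeMeasure T) := by
  obtain ⟨C, hC⟩ := isCompact_Icc.exists_bound_of_continuousOn (hφ.continuousOn (s := Icc 0 T))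
  refine hf.bdd_smul C hφ.aestronglyMeasurable ?_
  filter_upwards [ae_timeMeasure_mem T] with t ht using hC t ht

namespace HasH1Deriv

theorem congr (h : HasH1Deriv T f g) (hf : f =ᵐ[timeMeasure T] f')
    (hg : g =ᵐ[timeMeasure T] g') : HasH1Deriv T f' g' where
  memLp := h.memLp.ae_eq hf
  memLp_deriv := h.memLp_deriv.ae_eq hg
  integral_eq φ h1 h2 h3 := by
    have e1 : ∫ t, deriv φ t • f' t ∂(timeMeasure T) = ∫ t, deriv φ t • f t ∂(timeMeasure T) :=
      integral_congr_ae (by filter_upwards [hf] with t ht using by rw [ht])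
    have e2 : ∫ t, φ t • g' t ∂(timeMeasure T) = ∫ t, φ t • g t ∂(timeMeasure T) :=
      integral_congr_ae (by filter_upwards [hg] with t ht using by rw [ht])
    rw [e1, e2, h.integral_eq φ h1 h2 h3]

theorem mulVec (h : HasH1Deriv T f g) (A : Matrix κ' κ ℝ) :
    HasH1Deriv T (fun t => A *ᵥ f t) (fun t => A *ᵥ g t) where
  memLp := h.memLp.matrix_mulVec A
  memLp_deriv := h.memLp_deriv.matrix_mulVec A
  integral_eq φ h1 h2 h3 := by
    have e := congrArg A.mulVecCLM (h.integral_eq φ h1 h2 h3)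
    rw [map_neg, ← A.mulVecCLM.integral_comp_comm (integrable_timeMeasure_smul
        (h1.continuous_deriv (by simp)) (integrable_timeMeasure h.memLp)),
      ← A.mulVecCLM.integral_comp_comm (integrable_timeMeasure_smul h1.continuous
        (integrable_timeMeasure h.memLp_deriv))] at e
    simpa only [map_smul, mulVecCLM_apply] using e

theorem add (h : HasH1Deriv T f g) (h' : HasH1Deriv T f' g') :
    HasH1Deriv T (fun t => f t + f' t) (fun t => g t + g' t) where
  memLp := h.memLp.add h'.memLp
  memLp_deriv := h.memLp_deriv.add h'.memLp_deriv
  integral_eq φ h1 h2 h3 := by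
    have c1 := h1.continuous_deriv (by simp)
    have c0 := h1.continuous
    simp only [smul_add]
    rw [integral_add (integrable_timeMeasure_smul c1 (integrable_timeMeasure h.memLp))
        (integrable_timeMeasure_smul c1 (integrable_timeMeasure h'.memLp)),
      integral_add (integrable_timeMeasure_smul c0 (integrable_timeMeasure h.memLp_deriv))
        (integrable_timeMeasure_smul c0 (integrable_timeMeasure h'.memLp_deriv)),
      h.integral_eq φ h1 h2 h3, h'.integral_eq φ h1 h2 h3, neg_add]

theorem neg (h : HasH1Deriv T f g) : HasH1Deriv T (fun t => - f t) (fun t => - g t) where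
  memLp := h.memLp.neg
  memLp_deriv := h.memLp_deriv.neg
  integral_eq φ h1 h2 h3 := by
    simp only [smul_neg, integral_neg, h.integral_eq φ h1 h2 h3]

theorem sub (h : HasH1Deriv T f g) (h' : HasH1Deriv T f' g') :
    HasH1Deriv T (fun t => f t - f' t) (fun t => g t - g' t) := by
  simpa only [sub_eq_add_neg] using h.add h'.neg

theorem deriv_ae_eq_zero (h : HasH1Deriv T f g) (hf : f =ᵐ[timeMeasure T] 0) :
    g =ᵐ[timeMeasure T] 0 := by
  have := isOpen_Ioo.ae_eq_zero_of_integral_contDiff_smul_eq_zero (U := Ioo 0 T)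
    ((integrable_timeMeasure h.memLp_deriv).locallyIntegrable.locallyIntegrableOn _)
    fun φ h1 h2 h3 => by
      have e := h.integral_eq φ h1 h2 h3
      have e0 : ∫ t, deriv φ t • f t ∂(timeMeasure T) = 0 := by
        rw [← integral_zero ℝ (κ → ℝ) (μ := timeMeasure T)]
        exact integral_congr_ae (by filter_upwards [hf] with t ht using by simp [ht])
      rw [e0] at e
      exact neg_eq_zero.1 e.symm
  filter_upwards [this, ae_timeMeasure_mem_Ioo T] with t ht hm using ht hm

end HasH1Deriv

theorem HasInitialValue.mulVec {v : κ → ℝ} (h : HasInitialValue T f v) (A : Matrix κ' κ ℝ) :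
    HasInitialValue T (fun t => A *ᵥ f t) (A *ᵥ v) := by
  obtain ⟨F, hF, hFf, hv⟩ := h
  refine ⟨fun t => A *ᵥ F t, A.mulVecCLM.continuous.comp_continuousOn hF, ?_, by simp only [hv]⟩
  filter_upwards [hFf] with t ht using by rw [ht]

theorem HasInitialValue.congr {v : κ → ℝ} (h : HasInitialValue T f v)
    (hf : f =ᵐ[timeMeasure T] f') : HasInitialValue T f' v := by
  obtain ⟨F, hF, hFf, hv⟩ := h
  exact ⟨F, hF, hFf.trans hf, hv⟩

theorem HasInitialValue.add {v v' : κ → ℝ} (h : HasInitialValue T f v)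
    (h' : HasInitialValue T f' v') : HasInitialValue T (fun t => f t + f' t) (v + v') := by
  obtain ⟨F, hF, hFf, hv⟩ := h
  obtain ⟨F', hF', hFf', hv'⟩ := h'
  refine ⟨fun t => F t + F' t, hF.add hF', ?_, by simp only [hv, hv']⟩
  filter_upwards [hFf, hFf'] with t ht ht' using by rw [ht, ht']

theorem HasInitialValue.neg {v : κ → ℝ} (h : HasInitialValue T f v) :
    HasInitialValue T (fun t => - f t) (-v) := by
  obtain ⟨F, hF, hFf, hv⟩ := h
  refine ⟨fun t => - F t, hF.neg, ?_, by simp only [hv]⟩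
  filter_upwards [hFf] with t ht using by rw [ht]

theorem HasInitialValue.sub {v v' : κ → ℝ} (h : HasInitialValue T f v)
    (h' : HasInitialValue T f' v') : HasInitialValue T (fun t => f t - f' t) (v - v') := by
  simpa only [sub_eq_add_neg] using h.add h'.neg

/-- A smooth function with integral zero, compactly supported in an interval, is the derivative
of a function of the same kind. -/
theorem exists_deriv_eq_of_integral_eq_zero {a b : ℝ} {χ : ℝ → ℝ} (hχ : ContDiff ℝ ∞ χ)
    (hc : HasCompactSupport χ) (hs : tsupport χ ⊆ Ioo a b) (h0 : ∫ t, χ t = 0) :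
    ∃ Ψ : ℝ → ℝ, ContDiff ℝ ∞ Ψ ∧ HasCompactSupport Ψ ∧ tsupport Ψ ⊆ Ioo a b ∧ deriv Ψ = χ := by
  by_cases hne : (tsupport χ).Nonempty
  swap
  · have : χ = 0 := by
      rw [not_nonempty_iff_eq_empty, tsupport_eq_empty_iff] at hne
      exact hne
    subst this
    exact ⟨0, contDiff_const, HasCompactSupport.zero, by simp, by ext; simp⟩
  -- The primitive based at the least point `c` of the support vanishes to its left, and to the
  -- right of the greatest point `d` because the total integral is zero.
  obtain ⟨c, hcm, hcl⟩ := hc.isCompact.exists_isLeast hne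
  obtain ⟨d, hdm, hdl⟩ := hc.isCompact.exists_isGreatest hne
  have hχ0 : ∀ t, t ∉ Icc c d → χ t = 0 := fun t ht => by
    by_contra h
    have := subset_tsupport χ h
    exact ht ⟨hcl this, hdl this⟩
  have hder : ∀ t, HasDerivAt (fun t => ∫ s in c..t, χ s) (χ t) t := fun t =>
    hχ.continuous.integral_hasStrictDerivAt c t |>.hasDerivAt
  have hderiv : deriv (fun t => ∫ s in c..t, χ s) = χ := funext fun t => (hder t).deriv
  have hsupp : tsupport (fun t => ∫ s in c..t, χ s) ⊆ Icc c d := by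
    refine closure_minimal (fun t ht => ?_) isClosed_Icc
    by_contra htm
    refine ht ?_
    rcases lt_or_ge t c with htc | htc
    · simp only
      rw [intervalIntegral.integral_symm, intervalIntegral.integral_of_le htc.le,
        ← integral_Ico_eq_integral_Ioc, setIntegral_eq_zero_of_forall_eq_zero, neg_zero]
      exact fun s hs => hχ0 s fun h => absurd h.1 (not_le.2 hs.2)
    · have htd : d < t := by
        by_contra h
        exact htm ⟨htc, not_lt.1 h⟩
      simp only
      rw [intervalIntegral.integral_of_le htc, ← integral_Icc_eq_integral_Ioc,
        setIntegral_eq_integral_of_forall_compl_eq_zero, h0]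
      exact fun s hs => hχ0 s fun h => hs ⟨h.1, h.2.trans htd.le⟩
  have hsub : Icc c d ⊆ Ioo a b := fun t ht => ⟨(hs hcm).1.trans_le ht.1, ht.2.trans_lt (hs hdm).2⟩
  refine ⟨_, ?_, HasCompactSupport.of_support_subset_isCompact isCompact_Icc
    ((subset_tsupport _).trans hsupp), hsupp.trans hsub, hderiv⟩
  rw [contDiff_infty_iff_deriv, hderiv]
  exact ⟨fun t => (hder t).differentiableAt, hχ⟩

/-- The lemma of du Bois-Reymond: a function with vanishing weak derivative is constant. -/
theorem ae_eq_const_of_integral_deriv_smul_eq_zero (hT : 0 < T)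
    (hf : Integrable f (timeMeasure T))
    (h : ∀ φ : ℝ → ℝ, ContDiff ℝ ∞ φ → HasCompactSupport φ → tsupport φ ⊆ Ioo 0 T →
      ∫ t, deriv φ t • f t ∂(timeMeasure T) = 0) :
    ∃ c, f =ᵐ[timeMeasure T] fun _ => c := by
  -- A normalized bump supported in `[T/4, 3T/4]`; the constant will be the average of `f` against
  -- it.
  let η : ContDiffBump (T / 2) := ⟨T / 8, T / 4, by positivity, by linarith⟩
  let e : ℝ → ℝ := η.normed volume
  have he : ContDiff ℝ ∞ e := η.contDiff_normed
  have hec : HasCompactSupport e := η.hasCompactSupport_normed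
  have hes : tsupport e ⊆ Ioo 0 T := by
    rw [η.tsupport_normed_eq, Real.closedBall_eq_Icc]
    intro t ht
    have h1 : T / 2 - T / 4 ≤ t := ht.1
    have h2 : t ≤ T / 2 + T / 4 := ht.2
    constructor <;> linarith
  have hei : ∫ t, e t = 1 := η.integral_normed
  set c := ∫ t, e t • f t ∂(timeMeasure T) with hcdef
  refine ⟨c, ?_⟩
  have hfc : Integrable (fun t => f t - c) (timeMeasure T) := hf.sub (integrable_const c)
  have := isOpen_Ioo.ae_eq_zero_of_integral_contDiff_smul_eq_zero (U := Ioo 0 T)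
    (hfc.locallyIntegrable.locallyIntegrableOn _) fun ψ h1 h2 h3 => by
      -- Subtracting `k e` gives `ψ` mean zero, so the difference is the derivative of a test
      -- function and the hypothesis applies to it.
      set k := ∫ t, ψ t with hk
      have hχ : ContDiff ℝ ∞ fun t => ψ t - k * e t := h1.sub (contDiff_const.mul he)
      have hχs : tsupport (fun t => ψ t - k * e t) ⊆ tsupport ψ ∪ tsupport e := by
        refine closure_minimal (fun t ht => ?_)
          ((isClosed_tsupport ψ).union (isClosed_tsupport e))
        by_contra hn
        rw [mem_union, not_or] at hn
        exact ht (by simp [image_eq_zero_of_notMem_tsupport hn.1,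
          image_eq_zero_of_notMem_tsupport hn.2])
      have hχc : HasCompactSupport fun t => ψ t - k * e t :=
        HasCompactSupport.of_support_subset_isCompact (h2.isCompact.union hec.isCompact)
          ((subset_tsupport _).trans hχs)
      have ie : Integrable e := he.continuous.integrable_of_hasCompactSupport hec
      have iψ : Integrable ψ := h1.continuous.integrable_of_hasCompactSupport h2
      have hχ0 : ∫ t, (ψ t - k * e t) = 0 := by
        rw [integral_sub iψ (ie.const_mul k), integral_const_mul, hei, mul_one, ← hk, sub_self]
      obtain ⟨Ψ, g1, g2, g3, g4⟩ := exists_deriv_eq_of_integral_eq_zero hχ hχc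
        (hχs.trans (union_subset h3 hes)) hχ0
      have hz := h Ψ g1 g2 g3
      rw [g4] at hz
      simp only [sub_smul, mul_smul] at hz
      have hke : Integrable (fun t => k • e t • f t) (timeMeasure T) :=
        (integrable_timeMeasure_smul he.continuous hf).smul k
      rw [integral_sub (integrable_timeMeasure_smul h1.continuous hf) hke, integral_smul,
        ← hcdef] at hz
      simp only [smul_sub]
      rw [integral_sub (integrable_timeMeasure_smul h1.continuous hf)
        (integrable_timeMeasure_smul h1.continuous (integrable_const c)), integral_smul_const,
        integral_timeMeasure_of_support
          ((subset_tsupport ψ).trans (h3.trans Ioo_subset_Icc_self)), ← hk, hz]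
  filter_upwards [this, ae_timeMeasure_mem_Ioo T] with t ht hm using sub_eq_zero.1 (ht hm)

/-- Integration by parts for absolutely continuous functions; the primitive of `g` has derivative
`g` only almost everywhere. -/
theorem integral_deriv_mul_primitive {g : ℝ → ℝ} {b : ℝ}
    (hg : IntervalIntegrable g volume 0 b)
    {φ : ℝ → ℝ} (hφ : ContDiff ℝ 1 φ) (h0 : φ 0 = 0) (h1 : φ b = 0) :
    ∫ t in (0 : ℝ)..b, deriv φ t * ∫ s in (0 : ℝ)..t, g s = - ∫ t in (0 : ℝ)..b, φ t * g t := by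
  have hG := hg.absolutelyContinuousOnInterval_intervalIntegral (c := 0) (by simp)
  have hφ' : AbsolutelyContinuousOnInterval φ 0 b := hφ.contDiffOn.absolutelyContinuousOnInterval
  have h := hφ'.integral_mul_deriv_eq_deriv_mul hG
  rw [h0, h1, zero_mul, zero_mul, sub_zero, zero_sub] at h
  have e : ∫ t in (0 : ℝ)..b, φ t * g t
      = ∫ t in (0 : ℝ)..b, φ t * deriv (fun t => ∫ s in (0 : ℝ)..t, g s) t := by
    refine intervalIntegral.integral_congr_ae ?_
    filter_upwards [hg.ae_hasDerivAt_integral] with t ht hm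
    rw [(ht (uIoc_subset_uIcc hm) 0 (by simp)).deriv]
  rw [e, h, neg_neg]

theorem intervalIntegrable_of_timeMeasure (hg : Integrable g (timeMeasure T)) {t : ℝ}
    (ht : t ∈ Icc 0 T) : IntervalIntegrable g volume 0 t := by
  rw [intervalIntegrable_iff_integrableOn_Icc_of_le ht.1]
  exact IntegrableOn.mono_set hg (Icc_subset_Icc_right ht.2)

theorem continuousOn_primitive_timeMeasure (hT : 0 ≤ T) (hg : Integrable g (timeMeasure T))
    (c : κ → ℝ) : ContinuousOn (fun t => c + ∫ s in (0 : ℝ)..t, g s) (Icc 0 T) := by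
  have := intervalIntegral.continuousOn_primitive_interval (μ := volume) (f := g) (a := 0) (b := T)
    (by rw [uIcc_of_le hT]; exact hg)
  rw [uIcc_of_le hT] at this
  exact continuousOn_const.add this

theorem hasH1Deriv_primitive (hT : 0 ≤ T) (hg : MemLp g 2 (timeMeasure T)) (c : κ → ℝ) :
    HasH1Deriv T (fun t => c + ∫ s in (0 : ℝ)..t, g s) g where
  memLp := (continuousOn_primitive_timeMeasure hT (integrable_timeMeasure hg) c).memLp_timeMeasure 2
  memLp_deriv := hg
  integral_eq φ h1 h2 h3 := by
    have hgi := integrable_timeMeasure hg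
    have hF := (continuousOn_primitive_timeMeasure hT hgi c).memLp_timeMeasure 2
    have c1 := h1.continuous_deriv (by simp)
    have z0 : φ 0 = 0 := image_eq_zero_of_notMem_tsupport fun h => lt_irrefl _ (h3 h).1
    have zT : φ T = 0 := image_eq_zero_of_notMem_tsupport fun h => lt_irrefl _ (h3 h).2
    ext i
    rw [Pi.neg_apply, eval_integral fun i => (integrable_timeMeasure_smul c1
        (integrable_timeMeasure hF)).eval i,
      eval_integral fun i => (integrable_timeMeasure_smul h1.continuous hgi).eval i,
      integral_timeMeasure hT, integral_timeMeasure hT]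
    simp only [Pi.smul_apply, smul_eq_mul, Pi.add_apply]
    have hgT := intervalIntegrable_of_timeMeasure hgi ⟨hT, le_rfl⟩
    have hgiT : IntervalIntegrable (fun t => g t i) volume 0 T := by
      rw [intervalIntegrable_iff] at hgT ⊢
      exact Integrable.eval hgT i
    rw [← integral_deriv_mul_primitive hgiT (h1.of_le (by simp)) z0 zT]
    have hd : ∫ t in (0 : ℝ)..T, deriv φ t = 0 := by
      rw [intervalIntegral.integral_deriv_eq_sub (fun t _ => (h1.differentiable (by simp)) t)
        (c1.intervalIntegrable _ _), z0, zT, sub_zero]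
    have hP : ContinuousOn (fun t => ∫ s in (0 : ℝ)..t, g s i) (uIcc 0 T) :=
      intervalIntegral.continuousOn_primitive_interval (by
        rw [uIcc_of_le hT]
        exact (intervalIntegrable_iff_integrableOn_Icc_of_le hT).1 hgiT)
    have e : ∫ t in (0 : ℝ)..T, deriv φ t * (c i + (∫ s in (0 : ℝ)..t, g s) i)
        = ∫ t in (0 : ℝ)..T, (deriv φ t * c i + deriv φ t * ∫ s in (0 : ℝ)..t, g s i) := by
      refine intervalIntegral.integral_congr fun t ht => ?_
      rw [uIcc_of_le hT] at ht
      have hgt := intervalIntegrable_of_timeMeasure hgi ht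
      rw [intervalIntegral.integral_of_le ht.1, eval_integral fun i =>
        Integrable.eval ((intervalIntegrable_iff_integrableOn_Ioc_of_le ht.1).1 hgt) i,
        ← intervalIntegral.integral_of_le ht.1, mul_add]
    have i1 : IntervalIntegrable (fun t => deriv φ t * c i) volume 0 T :=
      (c1.mul continuous_const).intervalIntegrable _ _
    have i2 : IntervalIntegrable (fun t => deriv φ t * ∫ s in (0 : ℝ)..t, g s i) volume 0 T :=
      (c1.continuousOn.mul hP).intervalIntegrable
    rw [e, intervalIntegral.integral_add i1 i2, intervalIntegral.integral_mul_const, hd,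
      zero_mul, zero_add]

/-- Subtracting the primitive of `g` leaves a function with zero weak derivative, to which du
Bois-Reymond applies. -/
theorem HasH1Deriv.exists_ae_eq_primitive (hT : 0 < T) (h : HasH1Deriv T f g) :
    ∃ c, f =ᵐ[timeMeasure T] fun t => c + ∫ s in (0 : ℝ)..t, g s := by
  have h' := h.sub (hasH1Deriv_primitive hT.le h.memLp_deriv 0)
  obtain ⟨c, hc⟩ := ae_eq_const_of_integral_deriv_smul_eq_zero hT (integrable_timeMeasure h'.memLp)
    fun φ h1 h2 h3 => by
      rw [h'.integral_eq φ h1 h2 h3]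
      simp
  refine ⟨c, ?_⟩
  filter_upwards [hc] with t ht
  rw [← ht]
  simp

/-! ### Linear differential equations with integrable inhomogeneity -/

/-- Since `g` is merely integrable, write `y = w + Γ` with `Γ` the primitive of `g`. Then `w' = Cw +
CΓ` has a continuous right-hand side and is solved classically by variation of constants. -/
theorem exists_continuous_eq_add_integral {F : Type*} [NormedAddCommGroup F] [NormedSpace ℝ F]
    [CompleteSpace F] (C : F →L[ℝ] F) {g : ℝ → F} (hg : Integrable g) (x₀ : F) :
    ∃ y : ℝ → F, Continuous y ∧ ∀ t, y t = x₀ + ∫ s in (0 : ℝ)..t, (C (y s) + g s) := by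
  let Γ : ℝ → F := fun t => ∫ s in (0 : ℝ)..t, g s
  have hΓ : Continuous Γ := intervalIntegral.continuous_primitive (fun _ _ => hg.intervalIntegrable) 0
  let U : ℝ → F →L[ℝ] F := fun t => NormedSpace.exp (t • C)
  have hU : ∀ t, HasDerivAt U (C * U t) t := fun t => hasDerivAt_exp_smul_const' C t
  have hUc : Continuous U := continuous_iff_continuousAt.2 fun t => (hU t).continuousAt
  let _ : NormedAlgebra ℚ (F →L[ℝ] F) := NormedAlgebra.restrictScalars ℚ ℝ _
  have hUinv : ∀ t, U t * U (-t) = 1 := fun t => by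
    have := NormedSpace.exp_add_of_commute (𝔸 := F →L[ℝ] F)
      (((Commute.refl C).smul_left t).smul_right (-t))
    simp only [U]
    rw [← this, ← add_smul, add_neg_cancel, zero_smul, NormedSpace.exp_zero]
  let p : ℝ → F := fun t => U (-t) (C (Γ t))
  have hp : Continuous p := (hUc.comp continuous_neg).clm_apply (C.continuous.comp hΓ)
  let w : ℝ → F := fun t => U t (x₀ + ∫ s in (0 : ℝ)..t, p s)
  have hw : ∀ t, HasDerivAt w (C (w t) + C (Γ t)) t := fun t => by
    have h1 : HasDerivAt (fun t => x₀ + ∫ s in (0 : ℝ)..t, p s) (p t) t :=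
      (hp.integral_hasStrictDerivAt 0 t).hasDerivAt.const_add x₀
    have h2 := (hU t).clm_apply h1
    have h3 : U t (p t) = C (Γ t) := by
      have := congrArg (fun L : F →L[ℝ] F => L (C (Γ t))) (hUinv t)
      simpa [p] using this
    rw [h3] at h2
    exact h2
  have hwc : Continuous w := continuous_iff_continuousAt.2 fun t => (hw t).continuousAt
  have hw0 : w 0 = x₀ := by simp [w, U]
  refine ⟨fun t => w t + Γ t, hwc.add hΓ, fun t => ?_⟩
  have hcont : Continuous fun t => C (w t) + C (Γ t) :=
    (C.continuous.comp hwc).add (C.continuous.comp hΓ)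
  have hint := intervalIntegral.integral_eq_sub_of_hasDerivAt (fun s _ => hw s)
    (hcont.intervalIntegrable 0 t)
  simp only [map_add]
  rw [intervalIntegral.integral_add (hcont.intervalIntegrable 0 t) hg.intervalIntegrable, hint, hw0]
  simp only [Γ]
  abel

theorem exists_hasH1Deriv_linear (hT : 0 < T) (C : Matrix κ κ ℝ)
    (hg : MemLp g 2 (timeMeasure T)) (x₀ : κ → ℝ) :
    ∃ y : ℝ → κ → ℝ, HasH1Deriv T y (fun t => C *ᵥ y t + g t) ∧ HasInitialValue T y x₀ := by
  have hgi : Integrable ((Icc 0 T).indicator g) :=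
    (integrable_indicator_iff measurableSet_Icc).2 (integrable_timeMeasure hg)
  have hae : (Icc 0 T).indicator g =ᵐ[timeMeasure T] g := by
    filter_upwards [ae_timeMeasure_mem T] with t ht using indicator_of_mem ht g
  obtain ⟨y, hyc, hy⟩ := exists_continuous_eq_add_integral C.mulVecCLM hgi x₀
  refine ⟨y, ?_, y, hyc.continuousOn, Filter.EventuallyEq.rfl, by rw [hy 0]; simp⟩
  have hm : MemLp (fun t => C *ᵥ y t + (Icc 0 T).indicator g t) 2 (timeMeasure T) :=
    ((hyc.continuousOn.memLp_timeMeasure 2).matrix_mulVec C).add (hg.ae_eq hae.symm)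
  refine (hasH1Deriv_primitive hT.le hm x₀).congr (.of_forall fun t => (hy t).symm) ?_
  filter_upwards [hae] with t ht using by rw [ht]

theorem HasH1Deriv.ae_eq_zero_of_linear (hT : 0 < T) {C : Matrix κ κ ℝ} {y : ℝ → κ → ℝ}
    (h : HasH1Deriv T y (fun t => C *ᵥ y t)) (h0 : HasInitialValue T y 0) :
    y =ᵐ[timeMeasure T] 0 := by
  obtain ⟨c, hc⟩ := h.exists_ae_eq_primitive hT
  have hi := integrable_timeMeasure h.memLp_deriv
  have hYc := continuousOn_primitive_timeMeasure hT.le hi c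
  obtain ⟨F, hF, hFy, hF0⟩ := h0
  have hEq := Measure.eqOn_Icc_of_ae_eq volume hT.ne (hFy.trans hc) hF hYc
  have hyF : ∀ t ∈ Icc 0 T, F t = ∫ s in (0 : ℝ)..t, C *ᵥ F s := fun t ht => by
    have e0 := hEq ⟨le_rfl, hT.le⟩
    simp only [intervalIntegral.integral_same, add_zero, hF0] at e0
    have e1 := hEq ht
    simp only [← e0, zero_add] at e1
    rw [e1]
    refine intervalIntegral.integral_congr_ae_restrict ?_
    rw [uIoc_of_le ht.1]
    have h2 : y =ᵐ[volume.restrict (Ioc 0 t)] F := hFy.symm.filter_mono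
      (ae_mono (Measure.restrict_mono (Ioc_subset_Icc_self.trans (Icc_subset_Icc_right ht.2)) le_rfl))
    filter_upwards [h2] with s hs using by rw [hs]
  -- Constant extension of `F` beyond `[0, T]`, so that the primitive of `C H` is differentiable
  -- everywhere and classical ODE uniqueness can compare it with zero.
  let H : ℝ → κ → ℝ := IccExtend hT.le ((Icc 0 T).domRestrict F)
  have hHc : Continuous H := hF.domRestrict.Icc_extend'
  have hHF : ∀ t ∈ Icc 0 T, H t = F t := fun t ht => by simp [H, IccExtend_of_mem hT.le _ ht]
  have hder : ∀ t, HasDerivAt (fun t => ∫ s in (0 : ℝ)..t, C *ᵥ H s) (C *ᵥ H t) t := fun t =>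
    ((C.mulVecCLM.continuous.comp hHc).integral_hasStrictDerivAt 0 t).hasDerivAt
  have hW : ∀ t ∈ Icc 0 T, H t = ∫ s in (0 : ℝ)..t, C *ᵥ H s := fun t ht => by
    rw [hHF t ht, hyF t ht]
    refine intervalIntegral.integral_congr fun s hs => ?_
    rw [uIcc_of_le ht.1] at hs
    rw [hHF s ⟨hs.1, hs.2.trans ht.2⟩]
  have huniq := ODE_solution_unique (v := fun _ x => C.mulVecCLM x) (a := 0) (b := T)
    (f := fun t => ∫ s in (0 : ℝ)..t, C *ᵥ H s) (g := fun _ => 0) (K := ‖C.mulVecCLM‖₊)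
    (fun _ => C.mulVecCLM.lipschitz)
    (continuous_iff_continuousAt.2 fun t => (hder t).continuousAt).continuousOn
    (fun t ht => by
      have := (hder t).hasDerivWithinAt (s := Ici t)
      rw [hW t ⟨ht.1, ht.2.le⟩] at this
      exact this)
    continuousOn_const
    (fun t _ => by simpa using hasDerivWithinAt_const t (Ici t) (0 : κ → ℝ))
    (by simp)
  filter_upwards [hFy, ae_timeMeasure_mem T] with t ht hm
  rw [← ht, ← hHF t hm, hW t hm]
  exact huniq hm

end H1

/-! ### Solvability of the differential-algebraic equation -/

namespace IndexTwoSplitting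

variable {ι : Type*} [Fintype ι] [DecidableEq ι] {N P G : Matrix ι ι ℝ}

theorem mulVec_comm (h : IndexTwoSplitting N P G) (w : ι → ℝ) : P *ᵥ N *ᵥ w = N *ᵥ P *ᵥ w := by
  rw [mulVec_mulVec, mulVec_mulVec, h.comm]

theorem mulVec_idem (h : IndexTwoSplitting N P G) (w : ι → ℝ) : P *ᵥ P *ᵥ w = P *ᵥ w := by
  rw [mulVec_mulVec, h.idem]

theorem mulVec_nilp (h : IndexTwoSplitting N P G) (w : ι → ℝ) : N *ᵥ N *ᵥ P *ᵥ w = 0 := by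
  rw [mulVec_mulVec w N P, mulVec_mulVec, h.nilp, zero_mulVec]

theorem mulVec_left_inv (h : IndexTwoSplitting N P G) (w : ι → ℝ) :
    G *ᵥ N *ᵥ w = w - P *ᵥ w := by
  rw [mulVec_mulVec, h.left_inv, sub_mulVec, one_mulVec]

theorem mulVec_right_inv (h : IndexTwoSplitting N P G) (w : ι → ℝ) :
    N *ᵥ G *ᵥ w = w - P *ᵥ w := by
  rw [mulVec_mulVec, h.right_inv, sub_mulVec, one_mulVec]

theorem mulVec_comm_inv (h : IndexTwoSplitting N P G) (w : ι → ℝ) :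
    P *ᵥ G *ᵥ w = G *ᵥ P *ᵥ w := by
  rw [mulVec_mulVec, mulVec_mulVec, h.comm_inv]

/-- Solvability of `d/dt (N x) = N x - x + v`, `N x(0) = N x₀`. -/
theorem exists_solution (h : IndexTwoSplitting N P G) {T : ℝ} (hT : 0 < T) (x₀ : ι → ℝ)
    {v : ℝ → ι → ℝ} (hv : MemLp v 2 (timeMeasure T))
    (hH : MemH1 T (fun t => N *ᵥ P *ᵥ v t))
    (hI : HasInitialValue T (fun t => N *ᵥ P *ᵥ v t) (N *ᵥ P *ᵥ x₀)) :
    ∃ x : ℝ → ι → ℝ, MemLp x 2 (timeMeasure T) ∧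
      HasH1Deriv T (fun t => N *ᵥ x t) (fun t => N *ᵥ x t - x t + v t) ∧
      HasInitialValue T (fun t => N *ᵥ x t) (N *ᵥ x₀) := by
  obtain ⟨k, hk⟩ := hH
  -- Applying `G` to the equation on `ker P` gives `y' = (1 - G)y + Gv`. It is solved on the whole
  -- space and projected by `1 - P` afterwards.
  obtain ⟨y, hy, hy0⟩ := exists_hasH1Deriv_linear hT (1 - G) (hv.matrix_mulVec G) x₀
  have hPk : HasH1Deriv T (fun t => N *ᵥ P *ᵥ v t) (fun t => P *ᵥ k t) := by
    simpa only [h.mulVec_comm, h.mulVec_idem] using hk.mulVec P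
  have hNPk : (fun t => N *ᵥ P *ᵥ k t) =ᵐ[timeMeasure T] 0 :=
    (hPk.mulVec N).deriv_ae_eq_zero (.of_forall fun t => h.mulVec_nilp _)
  have hNx : (fun t => (N * (1 - P)) *ᵥ y t + N *ᵥ P *ᵥ v t) =ᵐ[timeMeasure T]
      fun t => N *ᵥ (y t - P *ᵥ y t + (P *ᵥ v t + N *ᵥ P *ᵥ v t) - P *ᵥ k t) := by
    filter_upwards [hNPk] with t ht
    simp only [Pi.zero_apply] at ht
    simp only [← mulVec_mulVec, sub_mulVec, one_mulVec, mulVec_sub, mulVec_add, h.mulVec_nilp, ht]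
    abel
  -- For `p = Px`, applying `N` to `(Np)' = Np - p + Pv` gives `Np = NPv`; substituting back, `p =
  -- Pv + NPv - (NPv)'`.
  refine ⟨fun t => y t - P *ᵥ y t + (P *ᵥ v t + N *ᵥ P *ᵥ v t) - P *ᵥ k t, ?_, ?_, ?_⟩
  · exact ((hy.memLp.sub (hy.memLp.matrix_mulVec P)).add ((hv.matrix_mulVec P).add hk.memLp)).sub
      hPk.memLp_deriv
  · refine ((hy.mulVec (N * (1 - P))).add hPk).congr hNx ?_
    filter_upwards [hNPk] with t ht
    simp only [Pi.zero_apply] at ht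
    simp only [← mulVec_mulVec, sub_mulVec, one_mulVec, mulVec_sub, mulVec_add, h.mulVec_nilp, ht,
      h.mulVec_right_inv, h.mulVec_comm_inv, h.mulVec_idem]
    abel
  · have := ((hy0.mulVec (N * (1 - P))).add hI).congr hNx
    convert this using 1
    simp only [← mulVec_mulVec, sub_mulVec, one_mulVec, mulVec_sub]
    abel

/-- Applying `NP` kills the left side and gives `NPd = 0`; applying `P` then gives `Pd = 0`. Hence
`d = GNd`, which solves `d' = (1 - G)d` with zero initial value. -/
theorem ae_eq_zero_of_solution (h : IndexTwoSplitting N P G) {T : ℝ} (hT : 0 < T)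
    {d : ℝ → ι → ℝ}
    (hd : HasH1Deriv T (fun t => N *ᵥ d t) (fun t => N *ᵥ d t - d t))
    (h0 : HasInitialValue T (fun t => N *ᵥ d t) 0) : d =ᵐ[timeMeasure T] 0 := by
  have hNPd : (fun t => N *ᵥ P *ᵥ d t) =ᵐ[timeMeasure T] 0 := by
    have := (hd.mulVec (N * P)).deriv_ae_eq_zero (.of_forall fun t => by
      simp only [← mulVec_mulVec, h.mulVec_comm, h.mulVec_nilp, Pi.zero_apply])
    filter_upwards [this] with t ht
    simpa only [← mulVec_mulVec, mulVec_sub, h.mulVec_comm, h.mulVec_nilp, zero_sub, Pi.zero_apply,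
      neg_eq_zero] using ht
  have hPd : (fun t => P *ᵥ d t) =ᵐ[timeMeasure T] 0 := by
    have := (hd.mulVec P).deriv_ae_eq_zero (by simpa only [h.mulVec_comm] using hNPd)
    filter_upwards [this, hNPd] with t ht ht'
    rw [Pi.zero_apply] at ht'
    simpa only [mulVec_sub, h.mulVec_comm, ht', zero_sub, Pi.zero_apply, neg_eq_zero] using ht
  have hGN : (fun t => G *ᵥ N *ᵥ d t) =ᵐ[timeMeasure T] d := by
    filter_upwards [hPd] with t ht
    rw [Pi.zero_apply] at ht
    rw [h.mulVec_left_inv, ht, sub_zero]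
  have hlin : HasH1Deriv T d (fun t => (1 - G) *ᵥ d t) := by
    refine (hd.mulVec G).congr hGN ?_
    filter_upwards [hGN] with t ht
    rw [mulVec_sub, ht, sub_mulVec, one_mulVec]
  refine hlin.ae_eq_zero_of_linear hT ?_
  simpa using (h0.mulVec G).congr hGN

end IndexTwoSplitting

/-- Multiplication by `S` turns the equation into `(Nx)' = Nx - x + SBu` with `N = SE`, because `S(J
- R)Q = N - 1`; multiplication by `E - (J - R)Q` goes back. -/
theorem existsUnique_isWeakSolution {ι κ : Type*} [Fintype ι] [DecidableEq ι] [Fintype κ]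
    {E J R Q S P G : Matrix ι ι ℝ} {B : Matrix ι κ ℝ} (hS : (E - (J - R) * Q) * S = 1)
    (h : IndexTwoSplitting (S * E) P G) {T : ℝ} (hT : 0 < T) (x₀ : ι → ℝ) {u : ℝ → κ → ℝ}
    (hu : MemLp u 2 (timeMeasure T)) (hH : MemH1 T (fun t => (S * E * P * S * B) *ᵥ u t))
    (hI : HasInitialValue T (fun t => (S * E * P * S * B) *ᵥ u t) ((S * E * P) *ᵥ x₀)) :
    ∃ x : ℝ → ι → ℝ, IsWeakSolution E J R Q B T x₀ u x ∧
      ∀ x' : ℝ → ι → ℝ, IsWeakSolution E J R Q B T x₀ u x' → x' =ᵐ[timeMeasure T] x := by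
  generalize hA : (J - R) * Q = A at hS
  have hS' : S * (E - A) = 1 := mul_eq_one_comm.1 hS
  have hSA : S * A = S * E - 1 := by rw [← hS']; noncomm_ring
  have hEN : ∀ w, (E - A) *ᵥ (S * E) *ᵥ w = E *ᵥ w := fun w => by
    rw [mulVec_mulVec, ← mul_assoc, hS, one_mul]
  have hv : MemLp (fun t => (S * B) *ᵥ u t) 2 (timeMeasure T) := hu.matrix_mulVec _
  have hNPv : (fun t => (S * E * P * S * B) *ᵥ u t)
      = fun t => (S * E) *ᵥ P *ᵥ (S * B) *ᵥ u t := by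
    funext t
    simp only [mulVec_mulVec, Matrix.mul_assoc]
  rw [hNPv] at hH hI
  rw [← mulVec_mulVec] at hI
  obtain ⟨x, hx, hxd, hx0⟩ := h.exists_solution hT x₀ hv hH hI
  have hsol : IsWeakSolution E J R Q B T x₀ u x := by
    have hEx : HasH1Deriv T (fun t => E *ᵥ x t) (fun t => A *ᵥ x t + B *ᵥ u t) := by
      refine (hxd.mulVec (E - A)).congr (.of_forall fun t => hEN _) (.of_forall fun t => ?_)
      have : (E - A) *ᵥ (S * B) *ᵥ u t = B *ᵥ u t := by
        rw [mulVec_mulVec, ← Matrix.mul_assoc, hS, Matrix.one_mul]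
      simp only
      rw [mulVec_add, mulVec_sub, hEN, this, sub_mulVec]
      abel
    refine ⟨hx, ⟨_, hEx⟩, ?_, _, hEx, .of_forall fun t => by rw [hA]⟩
    simpa only [hEN] using hx0.mulVec (E - A)
  refine ⟨x, hsol, fun x' hsol' => ?_⟩
  have hderiv : ∀ z, IsWeakSolution E J R Q B T x₀ u z →
      HasH1Deriv T (fun t => E *ᵥ z t) (fun t => A *ᵥ z t + B *ᵥ u t) := by
    intro z hz
    obtain ⟨g, hg, hge⟩ := hz.equation
    rw [hA] at hge
    exact hg.congr .rfl hge
  have hd := ((hderiv x' hsol').sub (hderiv x hsol)).mulVec S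
  have hd0 := (hsol'.initial.sub hsol.initial).mulVec S
  have key := h.ae_eq_zero_of_solution hT (d := fun t => x' t - x t)
    (hd.congr (.of_forall fun t => by simp only [← mulVec_mulVec, mulVec_sub])
      (.of_forall fun t => by
        simp only
        rw [add_sub_add_right_eq_sub, ← mulVec_sub, mulVec_mulVec, hSA, sub_mulVec, one_mulVec]))
    (by simpa only [← mulVec_mulVec, mulVec_sub, sub_self, mulVec_zero] using hd0)
  filter_upwards [key] with t ht using sub_eq_zero.1 ht

/-! ### The coupled system -/

theorem Matrix.PosSemidef.blockDiagonal' {s : ℕ} {n : Fin s → ℕ}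
    {M : ∀ i, Matrix (Fin (n i)) (Fin (n i)) ℝ} (h : ∀ i, (M i).PosSemidef) :
    (Matrix.blockDiagonal' M).PosSemidef := by
  have hfac : ∀ i, ∃ L : Matrix (Fin (n i)) (Fin (n i)) ℝ, M i = Lᴴ * L := fun i => by
    open scoped MatrixOrder Matrix.Norms.L2Operator in
    exact CStarAlgebra.nonneg_iff_eq_star_mul_self.1 (h i).nonneg
  choose L hL using hfac
  have : Matrix.blockDiagonal' M = (Matrix.blockDiagonal' L)ᴴ * Matrix.blockDiagonal' L := by
    rw [blockDiagonal'_conjTranspose, ← blockDiagonal'_mul]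
    congr 1
    funext i
    exact hL i
  rw [this]
  exact posSemidef_conjTranspose_mul_self _

theorem transpose_skewCoupling {s : ℕ} {n : Fin s → ℕ}
    {Jd : ∀ i, Matrix (Fin (n i)) (Fin (n i)) ℝ} (Jo : ∀ i j, Matrix (Fin (n i)) (Fin (n j)) ℝ)
    (hJ : ∀ i, (Jd i)ᵀ = - Jd i) : (skewCoupling Jd Jo)ᵀ = - skewCoupling Jd Jo := by
  have hd : (blockDiagonal' Jd)ᵀ = - blockDiagonal' Jd := by
    rw [blockDiagonal'_transpose, ← blockDiagonal'_neg]
    congr 1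
    funext i
    exact hJ i
  ext p q
  rw [transpose_apply, Matrix.neg_apply]
  simp only [skewCoupling, of_apply]
  rcases lt_trichotomy p.1 q.1 with h | h | h
  · simp [h, h.not_gt]
  · simp only [h, lt_irrefl, if_false]
    exact congrFun (congrFun hd p) q
  · simp [h, h.not_gt]

theorem Matrix.eq_zero_of_vecMul_eq_zero_of_rank {m n : Type*} [Fintype m] [Fintype n]
    {X : Matrix m n ℝ} (h : X.rank = Fintype.card m) {v : m → ℝ} (hv : v ᵥ* X = 0) : v = 0 := by
  classical
  rw [← rank_transpose, Matrix.rank] at h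
  have h1 := LinearMap.finrank_range_add_finrank_ker Xᵀ.mulVecLin
  rw [h, Module.finrank_fintype_fun_eq_card, Nat.add_eq_left, Submodule.finrank_eq_zero] at h1
  have : v ∈ LinearMap.ker Xᵀ.mulVecLin := by
    rw [LinearMap.mem_ker, mulVecLin_apply, mulVec_transpose, hv]
  rwa [h1, Submodule.mem_bot] at this

/-- A common kernel vector `v` of the three products makes `Qv` a common left null vector of `E`,
`R`, `J`: for `E` by the symmetry of `EᵀQ`, for `R` and `J` by cancelling `Qᵀ`. -/
theorem dissipativeTriple_congruence {ι : Type*} [Fintype ι] [DecidableEq ι]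
    {E R Q J : Matrix ι ι ℝ}
    (hR : R.PosSemidef) (hJ : Jᵀ = -J) (hEQ : Eᵀ * Q = Qᵀ * E) (hE : (Eᵀ * Q).PosSemidef)
    (hQ : IsUnit Q)
    (hker : ∀ v, v ᵥ* E = 0 → v ᵥ* R = 0 → v ᵥ* J = 0 → v = 0) :
    DissipativeTriple (Qᵀ * E) (Qᵀ * R * Q) (Qᵀ * J * Q) := by
  have hRs : Rᵀ = R := by simpa using hR.isHermitian.eq
  have hD : (Qᵀ * R * Q).PosSemidef := by simpa using hR.conjTranspose_mul_mul_same Q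
  rw [hEQ] at hE
  have hQi := mulVec_injective_iff_isUnit.2 hQ
  have hQt := mulVec_injective_iff_isUnit.2 ((isUnit_transpose Q).2 hQ)
  refine ⟨?_, fun v => ?_, fun v hv => ?_, ?_, fun v => ?_, fun v hv => ?_, ?_,
    fun v h1 h2 h3 => hQi ?_⟩
  · simpa using hE.isHermitian.eq
  · simpa using hE.dotProduct_mulVec_nonneg v
  · exact (hE.dotProduct_mulVec_zero_iff v).1 (by simpa using hv)
  · simpa using hD.isHermitian.eq
  · simpa using hD.dotProduct_mulVec_nonneg v
  · exact (hD.dotProduct_mulVec_zero_iff v).1 (by simpa using hv)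
  · simp [transpose_mul, hJ, Matrix.mul_assoc]
  · rw [mulVec_zero]
    have cancel : ∀ X : Matrix ι ι ℝ, (Qᵀ * X * Q) *ᵥ v = 0 → X *ᵥ Q *ᵥ v = 0 := fun X hX => by
      refine hQt ?_
      rw [mulVec_zero, mulVec_mulVec, mulVec_mulVec, hX]
    refine hker _ ?_ ?_ ?_
    · rw [← mulVec_transpose, mulVec_mulVec, hEQ, h1]
    · rw [← mulVec_transpose, hRs]
      exact cancel R h2
    · rw [← mulVec_transpose, hJ, neg_mulVec, cancel J h3, neg_zero]

/-- The nilpotent part of the pencil only sees the input through `Z₁ᵀ Zᵀ`. -/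
theorem DissipativeTriple.exists_factor {ι κ κ₁ : Type*} [Fintype ι] [DecidableEq ι] [Fintype κ]
    [Fintype κ₁] {M D K S P G : Matrix ι ι ℝ} (h : DissipativeTriple M D K)
    (hS : (M - (K - D)) * S = 1) (hP : IndexTwoSplitting (S * M) P G) {Z : Matrix ι κ ℝ}
    {Z₁ : Matrix κ κ₁ ℝ}
    (hZ : LinearMap.range Z.mulVecLin = LinearMap.ker M.mulVecLin)
    (hZ₁ : ∀ w, D *ᵥ Z *ᵥ w = 0 → Zᵀ *ᵥ K *ᵥ Z *ᵥ w = 0 → ∃ l, Z₁ *ᵥ l = w) :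
    ∃ L : Matrix ι κ₁ ℝ, S * M * P * S = L * (Z₁ᵀ * Zᵀ) ∧
      S * M * P = - (L * (Z₁ᵀ * Zᵀ) * K) := by
  classical
  have hZM : Zᵀ * M = 0 := by
    have : M * Z = 0 := by
      refine Matrix.toLin'.injective (LinearMap.ext fun w => ?_)
      have : Z *ᵥ w ∈ LinearMap.ker M.mulVecLin := hZ ▸ ⟨w, rfl⟩
      simpa [mulVec_mulVec] using this
    rw [← h.symm_M, ← transpose_mul, this, transpose_zero]
  have hmem : ∀ q, ∃ l, (Z * Z₁) *ᵥ l = (S * M * P * S)ᵀ *ᵥ q := fun q => by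
    obtain ⟨h1, h2, c, h3⟩ := h.transpose_mulVec_mem hS hP q
    have hr : (S * M * P * S)ᵀ *ᵥ q ∈ LinearMap.range Z.mulVecLin := by
      rw [hZ]
      exact h1
    obtain ⟨w, hw⟩ := hr
    rw [mulVecLin_apply] at hw
    obtain ⟨l, hl⟩ := hZ₁ w (by rw [hw, h2]) (by rw [hw, h3, mulVec_mulVec, hZM, zero_mulVec])
    exact ⟨l, by rw [← mulVec_mulVec, hl, hw]⟩
  -- The preimage of the `i`-th column of the transpose is the `i`-th row of the factor `L`.
  choose l hl using fun i => hmem (Pi.single i 1)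
  have hL : S * M * P * S = of l * (Z₁ᵀ * Zᵀ) := by
    ext i j
    have := congrFun (hl i) j
    rw [mulVec_single_one] at this
    simp only [col_apply, transpose_apply] at this
    rw [← this, ← transpose_mul, Matrix.mul_apply]
    simp only [mulVec, dotProduct, transpose_apply, of_apply]
    exact Finset.sum_congr rfl fun _ _ => mul_comm _ _
  refine ⟨of l, hL, ?_⟩
  have hD : S * M * P * S * D = 0 := by
    have : D * (S * M * P * S)ᵀ = 0 := by
      refine Matrix.toLin'.injective (LinearMap.ext fun q => ?_)
      simpa [mulVec_mulVec] using (h.transpose_mulVec_mem hS hP q).2.1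
    rw [← transpose_inj, transpose_mul, h.symm_D, this, transpose_zero]
  -- As `NPSD = 0` and `N²P = 0` for `N = SM`, this gives `NPSK = NP(N - 1) = -NP`, the identity
  -- that converts the compatibility condition.
  have hSK : S * K = S * M - 1 + S * D := by
    rw [← mul_eq_one_comm.1 hS]
    noncomm_ring
  rw [← hL, mul_assoc _ S K, hSK, mul_add, ← mul_assoc _ S D, hD, add_zero, mul_sub, mul_one,
    mul_assoc (S * M) P, ← hP.comm, hP.nilp, zero_sub, neg_neg]

theorem proposition2
    {s m r r₁ : ℕ} {n : Fin s → ℕ}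
    -- the blocks of the subsystems and of the coupling
    (Eb Rb Qb Jd : ∀ i, Matrix (Fin (n i)) (Fin (n i)) ℝ)
    (Jo : ∀ i j, Matrix (Fin (n i)) (Fin (n j)) ℝ)
    (Bb : ∀ i, Matrix (Fin (n i)) (Fin m) ℝ)
    (hR : ∀ i, (Rb i)ᵀ = Rb i ∧ (Rb i).PosSemidef)
    (hJ : ∀ i, (Jd i)ᵀ = - Jd i)
    (hEQ : ∀ i, (Eb i)ᵀ * Qb i = (Qb i)ᵀ * Eb i ∧ ((Eb i)ᵀ * Qb i).PosSemidef)
    (hQ : ∀ i, IsUnit (Qb i))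
    -- the overall matrices
    (E R Q J : Matrix (Σ i, Fin (n i)) (Σ i, Fin (n i)) ℝ)
    (B : Matrix (Σ i, Fin (n i)) (Fin m) ℝ)
    (hEb : E = Matrix.blockDiagonal' Eb) (hRb : R = Matrix.blockDiagonal' Rb)
    (hQb : Q = Matrix.blockDiagonal' Qb) (hJb : J = skewCoupling Jd Jo)
    (hBb : B = blockColumn Bb)
    (hrank : (Matrix.fromCols E (Matrix.fromCols R J)).rank = ∑ i, n i)
    -- final time, initial value and input
    (T : ℝ) (hT : 0 < T) (x₀ : (Σ i, Fin (n i)) → ℝ)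
    (u : ℝ → Fin m → ℝ) (hu : MemLp u 2 (timeMeasure T))
    -- compatibility of input and initial value
    (Z : Matrix (Σ i, Fin (n i)) (Fin r) ℝ) (Z₁ : Matrix (Fin r) (Fin r₁) ℝ)
    (hZrank : Z.rank = r) (hZ₁rank : Z₁.rank = r₁)
    (hZ : LinearMap.range Z.mulVecLin = LinearMap.ker E.mulVecLin)
    (hZ₁ : LinearMap.range Z₁.mulVecLin =
      LinearMap.ker (R * Q * Z).mulVecLin ⊓ LinearMap.ker (Zᵀ * Qᵀ * J * Q * Z).mulVecLin)
    (hH1 : MemH1 T (fun t => (Z₁ᵀ * Zᵀ * Qᵀ * B) *ᵥ u t))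
    (hinit : ∃ w : Fin r₁ → ℝ, HasInitialValue T (fun t => (Z₁ᵀ * Zᵀ * Qᵀ * B) *ᵥ u t) w ∧
      (Z₁ᵀ * Zᵀ * Qᵀ * J * Q) *ᵥ x₀ + w = 0) :
    IsRegularPencil E ((J - R) * Q) ∧
    (∃ x : ℝ → (Σ i, Fin (n i)) → ℝ, IsWeakSolution E J R Q B T x₀ u x ∧
      ∀ x' : ℝ → (Σ i, Fin (n i)) → ℝ, IsWeakSolution E J R Q B T x₀ u x' →
        x' =ᵐ[timeMeasure T] x) ∧
    (∃ ν : ℕ, HasIndex E ((J - R) * Q) ν ∧ ν ≤ 2) := by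
  have hEQ' : Eᵀ * Q = Qᵀ * E := by
    rw [hEb, hQb, blockDiagonal'_transpose, blockDiagonal'_transpose, ← blockDiagonal'_mul,
      ← blockDiagonal'_mul]
    congr 1
    funext i
    exact (hEQ i).1
  have hE' : (Eᵀ * Q).PosSemidef := by
    rw [hEb, hQb, blockDiagonal'_transpose, ← blockDiagonal'_mul]
    exact PosSemidef.blockDiagonal' fun i => (hEQ i).2
  have hR' : R.PosSemidef := hRb ▸ PosSemidef.blockDiagonal' fun i => (hR i).2
  have hJ' : Jᵀ = -J := by rw [hJb, transpose_skewCoupling Jo hJ]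
  have hQ' : IsUnit Q := by
    choose W hW using fun i => (hQ i).exists_right_inv
    refine IsUnit.of_mul_eq_one (blockDiagonal' W) ?_
    rw [hQb, ← blockDiagonal'_mul, ← blockDiagonal'_one]
    congr 1
    funext i
    exact hW i
  have hker : ∀ v, v ᵥ* E = 0 → v ᵥ* R = 0 → v ᵥ* J = 0 → v = 0 := fun v h1 h2 h3 => by
    refine eq_zero_of_vecMul_eq_zero_of_rank (X := fromCols E (fromCols R J)) ?_ ?_
    · rw [hrank]
      simp
    · rw [vecMul_fromCols, vecMul_fromCols, h1, h2, h3]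
      ext (_ | _ | _) <;> rfl
  have h := dissipativeTriple_congruence hR' hJ' hEQ' hE' hQ' hker
  have hfac : Qᵀ * E - (Qᵀ * J * Q - Qᵀ * R * Q) = Qᵀ * (E - (J - R) * Q) := by noncomm_ring
  obtain ⟨S, hS⟩ := h.isUnit.exists_right_inv
  have hS' : (E - (J - R) * Q) * (S * Qᵀ) = 1 := by
    rw [mul_eq_one_comm, Matrix.mul_assoc, ← hfac]
    exact mul_eq_one_comm.1 hS
  obtain ⟨P, G, hP⟩ := exists_indexTwoSplitting (S * (Qᵀ * E)) (h.mulVec_pow_three hS)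
  have hP' : IndexTwoSplitting (S * Qᵀ * E) P G := by rwa [Matrix.mul_assoc]
  have hQti := mulVec_injective_iff_isUnit.2 ((isUnit_transpose Q).2 hQ')
  obtain ⟨L, hL, hLK⟩ := h.exists_factor hS hP (Z := Z) (Z₁ := Z₁)
    (by
      rw [hZ]
      ext v
      simp only [LinearMap.mem_ker, mulVecLin_apply, ← mulVec_mulVec]
      exact ⟨fun hv => by rw [hv, mulVec_zero], fun hv => hQti (by simpa using hv)⟩)
    (fun w h1 h2 => by
      have : w ∈ LinearMap.range Z₁.mulVecLin := by
        rw [hZ₁, Submodule.mem_inf, LinearMap.mem_ker, LinearMap.mem_ker, mulVecLin_apply,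
          mulVecLin_apply]
        simp only [← mulVec_mulVec] at h1 h2 ⊢
        exact ⟨hQti (by simpa using h1), h2⟩
      exact this)
  have hLu : ∀ t, L *ᵥ (Z₁ᵀ * Zᵀ * Qᵀ * B) *ᵥ u t
      = (S * Qᵀ * E * P * (S * Qᵀ) * B) *ᵥ u t := fun t => by
    have : S * Qᵀ * E * P * (S * Qᵀ) * B = S * (Qᵀ * E) * P * S * Qᵀ * B := by
      simp only [Matrix.mul_assoc]
    rw [this, hL, mulVec_mulVec]
    simp only [Matrix.mul_assoc]
  have hreg : IsRegularPencil E ((J - R) * Q) :=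
    isRegularPencil_of_isUnit (IsUnit.of_mul_eq_one _ hS')
  refine ⟨hreg, existsUnique_isWeakSolution hS' hP' hT x₀ hu ?_ ?_, ?_⟩
  · obtain ⟨g, hg⟩ := hH1
    exact ⟨_, by simpa only [hLu] using hg.mulVec L⟩
  · obtain ⟨w, hw, hw0⟩ := hinit
    have := hw.mulVec L
    simp only [hLu] at this
    convert this using 1
    -- Compatibility says `w = -Z₁ᵀZᵀKx₀` with `K = QᵀJQ`; applying `L` gives `NPx₀`, the initial
    -- value required of `NPv`.
    rw [← neg_eq_of_add_eq_zero_right hw0, mulVec_neg, mulVec_mulVec, ← neg_mulVec,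
      Matrix.mul_assoc S, hLK]
    simp only [Matrix.mul_assoc]
  · have h2 : ResolventGrowth E ((J - R) * Q) 2 := resolventGrowth_two hS' hP'
    classical
    have hex : ∃ k, ResolventGrowth E ((J - R) * Q) k := ⟨2, h2⟩
    exact ⟨Nat.find hex, ⟨hreg, Nat.find_spec hex, fun k hk => Nat.find_min' hex hk⟩,
      Nat.find_min' hex h2⟩
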